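/- A Borel probability measure $\nu$ on $\mathbb{R}$ is called self-similar if there are finitely many maps $f_i(x)=s_i x+t_i$ $(1\le i\le n)$ with $s_i\in(-1,1)\setminus\{0\}$ and $t_i\in\mathbb{R}$, and a probability vector $(p_1,\dots,p_n)$ with all $p_i>0$, such that $\nu=\sum_{i=1}^n p_i\, f_i\nu$, where $f_i\nu$ is the push-forward of $\nu$ by $f_i$. For an integer $b\ge 2$ let $T_b(x)=bx \bmod 1\in[0,1)$; a number $x\in\mathbb{R}$ is normal to base $b$ if $\frac1N\sum_{n=1}^N\delta_{T_b^n(x)}$ converges in the weak-$*$ sense, as $N\to\infty$, to the Lebesgue measure on $[0,1]$. **Theorem.** Let $\nu$ be a non-atomic self-similar probability measure on $\mathbb{R}$. If its Fourier transform $\mathcal{F}_q(\nu)=\int e^{2\pi i x q}\,d\nu(x)$, $q\in\mathbb{R}$, satisfies $$\lim_{|q|\to\infty}\mathcal{F}_q(\nu)=0,$$ then $\nu$-almost every $x$ is normal to every integer base $b\ge 2$. -/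

import Mathlib

open MeasureTheory Filter Topology

/-- A self-similar iterated function system on `ℝ` with `n` maps `f i x = s i * x + t i`, each an
invertible contracting similarity. (Finitely many such maps always leave a common compact interval
invariant, e.g. `[-R, R]` with `R` large, so this is not recorded as a separate requirement.) -/
structure SelfSimilarIFS (n : ℕ) where
  s : Fin n → ℝ
  t : Fin n → ℝ
  s_ne_zero : ∀ i, s i ≠ 0
  abs_s_lt_one : ∀ i, |s i| < 1

/-- The `i`-th map of the system. -/
def SelfSimilarIFS.f {n : ℕ} (Φ : SelfSimilarIFS n) (i : Fin n) (x : ℝ) : ℝ :=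
  Φ.s i * x + Φ.t i

/-- `ν` is a self-similar probability measure: `ν = ∑ i, p i • (f i)_* ν` for some self-similar IFS
and some strictly positive probability vector `p`. -/
def IsSelfSimilarMeasure (ν : Measure ℝ) : Prop :=
  IsProbabilityMeasure ν ∧
    ∃ (n : ℕ) (Φ : SelfSimilarIFS n) (p : Fin n → ℝ),
      (∀ i, 0 < p i) ∧ ∑ i, p i = 1 ∧
        ν = ∑ i, ENNReal.ofReal (p i) • ν.map (Φ.f i)

/-- The Fourier transform `𝓕_q(μ) = ∫ exp(2πixq) dμ(x)`. -/
noncomputable def fourierMode (μ : Measure ℝ) (q : ℝ) : ℂ :=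
  ∫ x, Complex.exp (2 * Real.pi * Complex.I * x * q) ∂μ

/-- `μ` is Rajchman: `𝓕_q(μ) → 0` as `|q| → ∞`. -/
def IsRajchman (μ : Measure ℝ) : Prop :=
  Tendsto (fourierMode μ) (comap (fun q : ℝ => |q|) atTop) (𝓝 0)

/-- The times-`b` map `T_b(x) = b x mod 1`, with values in `[0, 1)`. -/
noncomputable def timesMap (b : ℕ) (x : ℝ) : ℝ := Int.fract ((b : ℝ) * x)

/-- `x` is normal to base `b`: the measures `(1/N) ∑_{n=1}^N δ_{T_b^n x}` converge to Lebesgue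
measure on `[0,1]` in the weak-* sense, that is, when tested against every continuous function
on `[0,1]`. -/
def IsNormalToBase (b : ℕ) (x : ℝ) : Prop :=
  ∀ g : ℝ → ℝ, ContinuousOn g (Set.Icc 0 1) →
    Tendsto (fun N : ℕ => (1 / (N : ℝ)) * ∑ n ∈ Finset.Icc 1 N, g ((timesMap b)^[n] x)) atTop
      (𝓝 (∫ y in Set.Icc (0 : ℝ) 1, g y))

/-- `x` is normal to every integer base `b ≥ 2`. -/
def IsAbsolutelyNormal (x : ℝ) : Prop :=
  ∀ b : ℕ, 2 ≤ b → IsNormalToBase b x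

/-- `μ`-almost every point is absolutely normal. -/
def IsPointwiseAbsolutelyNormal (μ : Measure ℝ) : Prop :=
  ∀ᵐ x ∂μ, IsAbsolutelyNormal x

/-!
Iterating the self-similarity writes `ν`, at any scale `ρ`, as a mixture of affine copies of itself
of size comparable to `ρ`. Let the frequencies `u k` grow by large factors, and choose `ρ` between
the scales of `u 0` and `u 1`: on each copy the first term of `S K x = ∑ cos (2π u k x + θ k)` is
almost constant, while the rescaled frequencies `u 1, u 2, …` are still so large that the Fourier
transform of `ν` is small there. By induction the exponential moments of `S K` are therefore
those of nearly independent, nearly centred terms, `∫ exp (ε S K) dν ≤ exp (4 ε² K)`, and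
Chernoff's bound with the Borel–Cantelli lemma gives `limsup S K / K ≤ 4 ε` almost surely. Any
lacunary sequence splits into finitely many sequences of such rapid growth, so Weyl's criterion
yields the equidistribution of `u n * x` modulo one; for `u n = b ^ (n + 1)` this is normality in
base `b`.
-/

namespace SelfSimilarIFS

variable {n : ℕ} (Φ : SelfSimilarIFS n)

theorem measurable_f (i : Fin n) : Measurable (Φ.f i) := by
  unfold SelfSimilarIFS.f
  fun_prop

theorem exists_abs_s_le : ∃ r, 0 < r ∧ r < 1 ∧ ∀ i, |Φ.s i| ≤ r := by
  have h : ∀ᶠ r in 𝓝[<] (1 : ℝ), ∀ i, |Φ.s i| ≤ r :=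
    eventually_all.2 fun i => mem_of_superset (Ioo_mem_nhdsLT (Φ.abs_s_lt_one i)) fun _ h => h.1.le
  obtain ⟨r, hr, hr0, hr1⟩ := (h.and (Ioo_mem_nhdsLT one_pos)).exists
  exact ⟨r, hr0, hr1, hr⟩

theorem exists_le_abs_s : ∃ c, 0 < c ∧ c ≤ 1 ∧ ∀ i, c ≤ |Φ.s i| := by
  have h : ∀ᶠ c in 𝓝[>] (0 : ℝ), ∀ i, c ≤ |Φ.s i| :=
    eventually_all.2 fun i =>
      mem_of_superset (Ioo_mem_nhdsGT (abs_pos.2 (Φ.s_ne_zero i))) fun _ h => h.2.le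
  obtain ⟨c, hc, hc0, hc1⟩ := (h.and (Ioo_mem_nhdsGT one_pos)).exists
  exact ⟨c, hc0, hc1.le, hc⟩

theorem exists_abs_f_sub_le : ∃ R r, 0 < r ∧ r < 1 ∧ ∀ i x, |Φ.f i x| - R ≤ r * (|x| - R) := by
  obtain ⟨r, hr0, hr1, hr⟩ := Φ.exists_abs_s_le
  have h : ∀ᶠ R : ℝ in atTop, ∀ i, |Φ.t i| ≤ R * (1 - r) := eventually_all.2 fun i =>
    (tendsto_id.atTop_mul_const (sub_pos.2 hr1)).eventually_ge_atTop _
  obtain ⟨R, hR⟩ := h.exists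
  refine ⟨R, r, hr0, hr1, fun i x => ?_⟩
  calc |Φ.s i * x + Φ.t i| - R ≤ |Φ.s i| * |x| + |Φ.t i| - R := by
        rw [← abs_mul]
        gcongr
        exact abs_add_le _ _
    _ ≤ r * |x| + R * (1 - r) - R := by gcongr <;> apply_assumption
    _ = r * (|x| - R) := by ring

end SelfSimilarIFS

/-- `ν` is, at every scale `ρ ≤ 1`, a mixture of its images under similarities with ratio between
`c * ρ` and `ρ`. This is phrased dually, as a comparison test for integrals, so that the weights
and the maps of the mixture need no names. -/
def IsMixtureOfCopies (ν : Measure ℝ) (c : ℝ) : Prop :=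
  ∀ ρ, 0 < ρ → ρ ≤ 1 → ∀ F G : ℝ → ℝ, Integrable F ν → Integrable G ν →
    (∀ s t, c * ρ ≤ |s| → |s| ≤ ρ → ∫ x, F (s * x + t) ∂ν ≤ ∫ x, G (s * x + t) ∂ν) →
      ∫ x, F x ∂ν ≤ ∫ x, G x ∂ν

section SelfSimilar

variable {ν : Measure ℝ} {n : ℕ} {Φ : SelfSimilarIFS n} {p : Fin n → ℝ}

theorem integrable_comp_of_selfSimilar (hp : ∀ i, 0 < p i)
    (hν : ν = ∑ i, ENNReal.ofReal (p i) • ν.map (Φ.f i)) {H : ℝ → ℝ} (hH : Integrable H ν)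
    (i : Fin n) : Integrable (fun x => H (Φ.f i x)) ν := by
  rw [hν, integrable_finsetSum_measure] at hH
  have hi := hH i (Finset.mem_univ i)
  rw [integrable_smul_measure (ENNReal.ofReal_pos.2 (hp i)).ne' ENNReal.ofReal_ne_top] at hi
  exact hi.comp_measurable (Φ.measurable_f i)

theorem integral_eq_sum_of_selfSimilar (hp : ∀ i, 0 < p i)
    (hν : ν = ∑ i, ENNReal.ofReal (p i) • ν.map (Φ.f i)) {H : ℝ → ℝ} (hH : Integrable H ν) :
    ∫ x, H x ∂ν = ∑ i, p i * ∫ x, H (Φ.f i x) ∂ν := by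
  have hint := hH
  rw [hν, integrable_finsetSum_measure] at hint
  conv_lhs => rw [hν, integral_finsetSum_measure hint]
  refine Finset.sum_congr rfl fun i _ => ?_
  have hi := (integrable_smul_measure (ENNReal.ofReal_pos.2 (hp i)).ne' ENNReal.ofReal_ne_top).1
    (hint i (Finset.mem_univ i))
  rw [integral_smul_measure, integral_map (Φ.measurable_f i).aemeasurable hi.aestronglyMeasurable,
    ENNReal.toReal_ofReal (hp i).le, smul_eq_mul]

theorem exists_isMixtureOfCopies (hp : ∀ i, 0 < p i)
    (hν : ν = ∑ i, ENNReal.ofReal (p i) • ν.map (Φ.f i)) :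
    ∃ c, 0 < c ∧ IsMixtureOfCopies ν c := by
  obtain ⟨r, hr0, hr1, hr⟩ := Φ.exists_abs_s_le
  obtain ⟨c, hc0, hc1, hc⟩ := Φ.exists_le_abs_s
  refine ⟨c, hc0, fun ρ hρ0 hρ1 F G hF hG hcopies => ?_⟩
  -- Words of the system are extended until their ratio drops below `ρ`; it cannot undershoot
  -- `ρ` by more than the factor `c`.
  have descend : ∀ m : ℕ, ∀ s t, Integrable (fun x => F (s * x + t)) ν →
      Integrable (fun x => G (s * x + t)) ν → c * ρ ≤ |s| → r ^ m * |s| ≤ ρ →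
      ∫ x, F (s * x + t) ∂ν ≤ ∫ x, G (s * x + t) ∂ν := by
    intro m
    induction m with
    | zero => exact fun s t _ _ hs hm => hcopies s t hs (by simpa using hm)
    | succ m ih =>
      intro s t hF hG hs hm
      rcases le_or_gt |s| ρ with hsρ | hρs
      · exact hcopies s t hs hsρ
      have hcomp : ∀ i x, s * Φ.f i x + t = s * Φ.s i * x + (s * Φ.t i + t) := fun i x => by
        rw [SelfSimilarIFS.f]
        ring
      have hF' := integrable_comp_of_selfSimilar hp hν hF
      have hG' := integrable_comp_of_selfSimilar hp hν hG
      rw [integral_eq_sum_of_selfSimilar hp hν hF, integral_eq_sum_of_selfSimilar hp hν hG]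
      simp only [hcomp] at hF' hG' ⊢
      refine Finset.sum_le_sum fun i _ => mul_le_mul_of_nonneg_left
        (ih _ _ (hF' i) (hG' i) ?_ ?_) (hp i).le <;> rw [abs_mul]
      · rw [mul_comm |s|]
        exact mul_le_mul (hc i) hρs.le hρ0.le (abs_nonneg _)
      · calc r ^ m * (|s| * |Φ.s i|) ≤ r ^ m * (|s| * r) := by gcongr; exact hr i
          _ = r ^ (m + 1) * |s| := by ring
          _ ≤ ρ := hm
  obtain ⟨m, hm⟩ := exists_pow_lt_of_lt_one hρ0 hr1
  simpa using descend m 1 0 (by simpa using hF) (by simpa using hG)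
    (by simpa using mul_le_one₀ hc1 hρ0.le hρ1) (by simpa using hm.le)

theorem exists_ae_abs_le_of_selfSimilar [IsFiniteMeasure ν] (hp : ∀ i, 0 < p i)
    (hp1 : ∑ i, p i = 1) (hν : ν = ∑ i, ENNReal.ofReal (p i) • ν.map (Φ.f i)) :
    ∃ R, ∀ᵐ x ∂ν, |x| ≤ R := by
  obtain ⟨R, r, hr0, hr1, hR⟩ := Φ.exists_abs_f_sub_le
  -- Every map shrinks the excess `ψ x = max 0 (|x| - R)` by `r`, while `ν` is invariant;
  -- composing with `arctan` makes `ψ` integrable.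
  set ψ : ℝ → ℝ := fun x => max 0 (|x| - R)
  have hψ : ∀ i x, ψ (Φ.f i x) ≤ r * ψ x := fun i x => by
    rw [mul_max_of_nonneg _ _ hr0.le, mul_zero]
    exact max_le_max le_rfl (hR i x)
  have hint : ∀ a, Integrable (fun x => Real.arctan (a * ψ x)) ν := fun a =>
    Integrable.of_bound (by fun_prop) (Real.pi / 2) (.of_forall fun x =>
      abs_le.2 ⟨(Real.neg_pi_div_two_lt_arctan _).le, (Real.arctan_lt_pi_div_two _).le⟩)
  have hint₁ : Integrable (fun x => Real.arctan (ψ x)) ν := by simpa using hint 1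
  have hle : ∀ x, Real.arctan (r * ψ x) ≤ Real.arctan (ψ x) := fun x =>
    Real.arctan_mono (mul_le_of_le_one_left (le_max_left _ _) hr1.le)
  have hge : ∫ x, Real.arctan (ψ x) ∂ν ≤ ∫ x, Real.arctan (r * ψ x) ∂ν := by
    calc ∫ x, Real.arctan (ψ x) ∂ν = ∑ i, p i * ∫ x, Real.arctan (ψ (Φ.f i x)) ∂ν :=
          integral_eq_sum_of_selfSimilar hp hν hint₁
      _ ≤ ∑ i, p i * ∫ x, Real.arctan (r * ψ x) ∂ν := by
          gcongr with i
          · exact (hp i).le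
          · exact integrable_comp_of_selfSimilar hp hν hint₁ i
          · exact hint r
          · exact fun x => Real.arctan_mono (hψ i x)
      _ = ∫ x, Real.arctan (r * ψ x) ∂ν := by rw [← Finset.sum_mul, hp1, one_mul]
  have heq := (integral_eq_iff_of_ae_le (hint r) hint₁ (.of_forall hle)).1
    (le_antisymm (integral_mono (hint r) hint₁ hle) hge)
  refine ⟨R, ?_⟩
  filter_upwards [heq] with x hx
  have hfix : r * ψ x = ψ x := Real.arctan_injective hx
  have hzero : ψ x = 0 := by nlinarith
  exact sub_nonpos.1 (max_eq_left_iff.1 hzero)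

end SelfSimilar

section Rajchman

variable {ν : Measure ℝ}

theorem IsRajchman.exists_norm_fourierMode_le (hR : IsRajchman ν) {ε : ℝ} (hε : 0 < ε) :
    ∃ Q, 0 < Q ∧ ∀ ξ, Q ≤ |ξ| → ‖fourierMode ν ξ‖ ≤ ε := by
  have h : ∀ᶠ a in atTop, ∀ ξ, |ξ| = a → fourierMode ν ξ ∈ Metric.closedBall 0 ε :=
    eventually_comap.1 (hR (Metric.closedBall_mem_nhds 0 hε))
  obtain ⟨Q, hQ⟩ := eventually_atTop.1 h
  refine ⟨max Q 1, by positivity, fun ξ hξ => ?_⟩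
  simpa using hQ |ξ| ((le_max_left _ _).trans hξ) ξ rfl

variable [IsProbabilityMeasure ν]

theorem integral_cos_le_norm_fourierMode (ξ α : ℝ) :
    ∫ x, Real.cos (2 * Real.pi * (ξ * x) + α) ∂ν ≤ ‖fourierMode ν ξ‖ := by
  have hexp : ∀ x : ℝ, Complex.exp (2 * Real.pi * Complex.I * x * ξ)
      = Complex.exp ((2 * Real.pi * (ξ * x) : ℝ) * Complex.I) := fun x => by
    push_cast
    ring_nf
  have hint : Integrable (fun x : ℝ => Complex.exp (α * Complex.I) *
      Complex.exp (2 * Real.pi * Complex.I * x * ξ)) ν :=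
    Integrable.of_bound (by fun_prop) 1 (.of_forall fun x => by
      rw [hexp, norm_mul, Complex.norm_exp_ofReal_mul_I, Complex.norm_exp_ofReal_mul_I, one_mul])
  calc ∫ x, Real.cos (2 * Real.pi * (ξ * x) + α) ∂ν
      = ∫ x : ℝ, (Complex.exp (α * Complex.I) *
          Complex.exp (2 * Real.pi * Complex.I * x * ξ)).re ∂ν := by
        congr with x
        rw [hexp, ← Complex.exp_add, ← add_mul, ← Complex.ofReal_add, add_comm α,
          Complex.exp_ofReal_mul_I_re]
    _ = (Complex.exp (α * Complex.I) * fourierMode ν ξ).re := by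
        rw [fourierMode, ← integral_const_mul]
        exact integral_re hint
    _ ≤ ‖fourierMode ν ξ‖ := by
        refine (Complex.re_le_norm _).trans ?_
        rw [norm_mul, Complex.norm_exp_ofReal_mul_I, one_mul]

theorem integral_exp_cos_le {ε ξ : ℝ} (hε : 0 ≤ ε) (hε1 : ε ≤ 1) (hξ : ‖fourierMode ν ξ‖ ≤ ε)
    (α : ℝ) :
    ∫ x, Real.exp (ε * Real.cos (2 * Real.pi * (ξ * x) + α)) ∂ν ≤ Real.exp (2 * ε ^ 2) := by
  have hexp : ∀ y, |y| ≤ 1 → Real.exp (ε * y) ≤ 1 + ε ^ 2 + ε * y := fun y hy => by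
    have hεy : |ε * y| ≤ ε := by
      rw [abs_mul, abs_of_nonneg hε]
      exact mul_le_of_le_one_right hε hy
    have hquad := (abs_le.1 (Real.abs_exp_sub_one_sub_id_le (hεy.trans hε1))).2
    have hsq : (ε * y) ^ 2 ≤ ε ^ 2 := sq_le_sq' (abs_le.1 hεy).1 (abs_le.1 hεy).2
    linarith
  have hcos : Integrable (fun x => Real.cos (2 * Real.pi * (ξ * x) + α)) ν :=
    Integrable.of_bound (by fun_prop) 1 (.of_forall fun x => Real.abs_cos_le_one _)
  calc ∫ x, Real.exp (ε * Real.cos (2 * Real.pi * (ξ * x) + α)) ∂ν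
      ≤ ∫ x, (1 + ε ^ 2 + ε * Real.cos (2 * Real.pi * (ξ * x) + α)) ∂ν :=
        integral_mono_of_nonneg (.of_forall fun x => (Real.exp_pos _).le)
          ((integrable_const _).add (hcos.const_mul _))
          (.of_forall fun x => hexp _ (Real.abs_cos_le_one _))
    _ = 1 + ε ^ 2 + ε * ∫ x, Real.cos (2 * Real.pi * (ξ * x) + α) ∂ν := by
        rw [integral_add (integrable_const _) (hcos.const_mul _), integral_const_mul]
        simp
    _ ≤ 1 + ε ^ 2 + ε * ε := by
        gcongr
        exact (integral_cos_le_norm_fourierMode ξ α).trans hξ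
    _ ≤ Real.exp (2 * ε ^ 2) := by linarith [Real.add_one_le_exp (2 * ε ^ 2)]

end Rajchman

/-- Cosine polynomials with real frequencies `u k` and phases `θ k`, the family in which the
trigonometric sums `∑ exp(2πi u_k x)` stay under affine changes of variable. -/
noncomputable def cosSum (u θ : ℕ → ℝ) (K : ℕ) (x : ℝ) : ℝ :=
  ∑ k ∈ Finset.range K, Real.cos (2 * Real.pi * (u k * x) + θ k)

theorem sum_range_le_of_le_one {a : ℕ → ℝ} (ha : ∀ n, a n ≤ 1) (m : ℕ) :
    ∑ n ∈ Finset.range m, a n ≤ m := by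
  simpa using Finset.sum_le_card_nsmul (Finset.range m) a 1 fun n _ => ha n

section CosSum

variable (u θ : ℕ → ℝ) (K : ℕ)

theorem cosSum_succ (x : ℝ) :
    cosSum u θ (K + 1) x = Real.cos (2 * Real.pi * (u 0 * x) + θ 0) +
      cosSum (fun k => u (k + 1)) (fun k => θ (k + 1)) K x := by
  rw [cosSum, Finset.sum_range_succ', add_comm, cosSum]

theorem cosSum_affine (s t x : ℝ) :
    cosSum u θ K (s * x + t) =
      cosSum (fun k => u k * s) (fun k => 2 * Real.pi * (u k * t) + θ k) K x := by
  refine Finset.sum_congr rfl fun k _ => congrArg Real.cos ?_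
  ring

theorem cosSum_le (x : ℝ) : cosSum u θ K x ≤ K :=
  sum_range_le_of_le_one (fun _ => Real.cos_le_one _) K

theorem continuous_cosSum : Continuous (cosSum u θ K) := by
  unfold cosSum
  fun_prop

theorem integrable_exp_mul_cosSum {ν : Measure ℝ} [IsFiniteMeasure ν] {ε : ℝ} (hε : 0 ≤ ε) :
    Integrable (fun x => Real.exp (ε * cosSum u θ K x)) ν := by
  have hcont := continuous_cosSum u θ K
  refine Integrable.of_bound (by fun_prop) (Real.exp (ε * K)) (.of_forall fun x => ?_)
  rw [Real.norm_eq_abs, Real.abs_exp]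
  gcongr
  exact cosSum_le u θ K x

end CosSum

theorem integral_mul_le_of_le_of_le_mul {α : Type*} [MeasurableSpace α] {μ : Measure α}
    [IsProbabilityMeasure μ] {f g : α → ℝ} {m κ : ℝ} (hf : Integrable f μ) (hg : Integrable g μ)
    (hfg : Integrable (fun x => f x * g x) μ) (hg0 : 0 ≤ g) (hκ : 0 ≤ κ)
    (hmf : ∀ᵐ x ∂μ, m ≤ f x) (hfm : ∀ᵐ x ∂μ, f x ≤ κ * m) :
    ∫ x, f x * g x ∂μ ≤ κ * (∫ x, f x ∂μ) * ∫ x, g x ∂μ := by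
  have hm : m ≤ ∫ x, f x ∂μ := by
    simpa using integral_mono_ae (integrable_const m) hf hmf
  calc ∫ x, f x * g x ∂μ ≤ ∫ x, κ * m * g x ∂μ := by
        refine integral_mono_ae hfg (hg.const_mul _) ?_
        filter_upwards [hfm] with x hx
        exact mul_le_mul_of_nonneg_right hx (hg0 x)
    _ = κ * m * ∫ x, g x ∂μ := integral_const_mul _ _
    _ ≤ κ * (∫ x, f x ∂μ) * ∫ x, g x ∂μ := by
        gcongr
        exact integral_nonneg hg0

-- At the scale `ρ` a term of frequency `a` hardly varies over a copy, while the next frequency `b`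
-- is still at least `Q` on it.
theorem exists_intermediate_scale {c D Q R ε a b : ℝ} (hc : 0 < c) (hQ : 0 < Q) (hR : 0 ≤ R)
    (hcD : 1 ≤ c * D) (hRD : 2 * Real.pi * (Q * R) ≤ c * D * ε) (ha : Q ≤ a) (hab : D * a ≤ b) :
    ∃ ρ, 0 < ρ ∧ ρ ≤ 1 ∧ c * ρ * b = Q ∧ 2 * Real.pi * (a * ρ * R) ≤ ε := by
  have hcDa : c * D * a ≤ c * b := by
    rw [mul_assoc]
    gcongr
  have hQb : Q ≤ c * b :=
    (ha.trans (le_mul_of_one_le_left (hQ.le.trans ha) hcD)).trans hcDa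
  have hcb : 0 < c * b := hQ.trans_le hQb
  have hρ : c * b * (Q / (c * b)) = Q := mul_div_cancel₀ Q hcb.ne'
  refine ⟨Q / (c * b), by positivity, (div_le_one hcb).2 hQb, by rwa [mul_right_comm], ?_⟩
  refine le_of_mul_le_mul_left ?_ (one_pos.trans_le hcD)
  calc c * D * (2 * Real.pi * (a * (Q / (c * b)) * R))
      = 2 * Real.pi * (c * D * a * (Q / (c * b)) * R) := by ring
    _ ≤ 2 * Real.pi * (c * b * (Q / (c * b)) * R) := by gcongr
    _ ≤ c * D * ε := by rwa [hρ]

section Moment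

variable {ν : Measure ℝ} [IsProbabilityMeasure ν] {R ε : ℝ}

theorem integral_exp_cosSum_succ_le (hR : ∀ᵐ x ∂ν, |x| ≤ R) (hε : 0 ≤ ε) {u : ℕ → ℝ}
    (hu : 2 * Real.pi * (|u 0| * R) ≤ ε) (θ : ℕ → ℝ) (K : ℕ) :
    ∫ x, Real.exp (ε * cosSum u θ (K + 1) x) ∂ν ≤
      Real.exp (2 * ε ^ 2) * (∫ x, Real.exp (ε * cosSum u θ 1 x) ∂ν) *
        ∫ x, Real.exp (ε * cosSum (fun k => u (k + 1)) (fun k => θ (k + 1)) K x) ∂ν := by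
  have hosc : ∀ᵐ x ∂ν, |cosSum u θ 1 x - Real.cos (θ 0)| ≤ ε := by
    filter_upwards [hR] with x hx
    calc |cosSum u θ 1 x - Real.cos (θ 0)|
        ≤ |2 * Real.pi * (u 0 * x) + θ 0 - θ 0| := by
          simpa [cosSum] using Real.abs_cos_sub_cos_le (2 * Real.pi * (u 0 * x) + θ 0) (θ 0)
      _ = 2 * Real.pi * (|u 0| * |x|) := by
          rw [add_sub_cancel_right, abs_mul, abs_of_pos Real.two_pi_pos, abs_mul]
      _ ≤ ε := le_trans (by gcongr) hu
  have hsplit : ∀ x, Real.exp (ε * cosSum u θ (K + 1) x) = Real.exp (ε * cosSum u θ 1 x) *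
      Real.exp (ε * cosSum (fun k => u (k + 1)) (fun k => θ (k + 1)) K x) := fun x => by
    rw [← Real.exp_add, ← mul_add, cosSum_succ u θ K, cosSum_succ u θ 0]
    simp [cosSum]
  have hint := integrable_exp_mul_cosSum (ν := ν) u θ (K + 1) hε
  simp only [hsplit] at hint ⊢
  refine integral_mul_le_of_le_of_le_mul (m := Real.exp (ε * (Real.cos (θ 0) - ε)))
    (integrable_exp_mul_cosSum u θ 1 hε) (integrable_exp_mul_cosSum _ _ K hε) hint
    (fun x => (Real.exp_pos _).le) (Real.exp_pos _).le ?_ ?_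
  all_goals filter_upwards [hosc] with x hx
  · gcongr
    linarith [(abs_le.1 hx).1]
  · rw [← Real.exp_add]
    gcongr
    nlinarith [(abs_le.1 hx).2]

theorem integral_exp_cosSum_succ_le_of_isMixtureOfCopies {c ρ B : ℝ}
    (hmix : IsMixtureOfCopies ν c) (hR : ∀ᵐ x ∂ν, |x| ≤ R) (hε : 0 ≤ ε) (hρ : 0 < ρ) (hρ1 : ρ ≤ 1)
    {u θ : ℕ → ℝ} (hu : 2 * Real.pi * (|u 0| * ρ * R) ≤ ε) {K : ℕ}
    (hB : ∀ s t, c * ρ ≤ |s| → |s| ≤ ρ → ∫ x, Real.exp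
      (ε * cosSum (fun k => u (k + 1)) (fun k => θ (k + 1)) K (s * x + t)) ∂ν ≤ B) :
    ∫ x, Real.exp (ε * cosSum u θ (K + 1) x) ∂ν ≤
      Real.exp (2 * ε ^ 2) * B * ∫ x, Real.exp (ε * cosSum u θ 1 x) ∂ν := by
  have hint := fun v φ L => integrable_exp_mul_cosSum (ν := ν) v φ L hε
  rw [← integral_const_mul]
  refine hmix ρ hρ hρ1 _ _ (hint u θ _) ((hint u θ 1).const_mul _) fun s t hs hsρ => ?_
  have hBst := hB s t hs hsρ
  simp only [cosSum_affine, integral_const_mul] at hBst ⊢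
  have hslow : 2 * Real.pi * (|u 0 * s| * R) ≤ ε := by
    have hR0 : 0 ≤ R := (abs_nonneg _).trans hR.exists.choose_spec
    rw [abs_mul]
    exact le_trans (by gcongr) hu
  refine (integral_exp_cosSum_succ_le hR hε hslow _ K).trans ?_
  rw [mul_right_comm]
  have : 0 ≤ ∫ x, Real.exp (ε * cosSum (fun k => u k * s)
      (fun k => 2 * Real.pi * (u k * t) + θ k) 1 x) ∂ν :=
    integral_nonneg fun x => (Real.exp_pos _).le
  gcongr

theorem integral_exp_cosSum_le {c D Q : ℝ} (hc : 0 < c) (hmix : IsMixtureOfCopies ν c)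
    (hR : ∀ᵐ x ∂ν, |x| ≤ R) (hε : 0 ≤ ε) (hε1 : ε ≤ 1) (hQ : 0 < Q)
    (hF : ∀ ξ, Q ≤ |ξ| → ‖fourierMode ν ξ‖ ≤ ε) (hcD : 1 ≤ c * D)
    (hRD : 2 * Real.pi * (Q * R) ≤ c * D * ε) (K : ℕ) :
    ∀ u θ : ℕ → ℝ, Q ≤ |u 0| → (∀ k, D * |u k| ≤ |u (k + 1)|) →
      ∫ x, Real.exp (ε * cosSum u θ K x) ∂ν ≤ Real.exp (4 * ε ^ 2 * K) := by
  have hR0 : 0 ≤ R := (abs_nonneg _).trans hR.exists.choose_spec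
  induction K with
  | zero => simp [cosSum]
  | succ K ih =>
    intro u θ hu0 hu
    obtain ⟨ρ, hρ0, hρ1, hρ, hslow⟩ := exists_intermediate_scale hc hQ hR0 hcD hRD hu0 (hu 0)
    have hfirst : ∫ x, Real.exp (ε * cosSum u θ 1 x) ∂ν ≤ Real.exp (2 * ε ^ 2) := by
      simpa [cosSum] using integral_exp_cos_le hε hε1 (hF _ hu0) (θ 0)
    calc ∫ x, Real.exp (ε * cosSum u θ (K + 1) x) ∂ν
        ≤ Real.exp (2 * ε ^ 2) * Real.exp (4 * ε ^ 2 * K) *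
            ∫ x, Real.exp (ε * cosSum u θ 1 x) ∂ν := by
          refine integral_exp_cosSum_succ_le_of_isMixtureOfCopies hmix hR hε hρ0 hρ1
            hslow fun s t hs _ => ?_
          simp only [cosSum_affine]
          refine ih _ _ ?_ fun k => ?_
          · calc Q = |u 1| * (c * ρ) := by rw [← hρ, zero_add, mul_comm]
              _ ≤ |u 1| * |s| := by gcongr
              _ = |u (0 + 1) * s| := by rw [abs_mul, zero_add]
          · simpa only [abs_mul, mul_assoc] using
              mul_le_mul_of_nonneg_right (hu (k + 1)) (abs_nonneg s)
      _ ≤ Real.exp (2 * ε ^ 2) * Real.exp (4 * ε ^ 2 * K) * Real.exp (2 * ε ^ 2) := by gcongr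
      _ = Real.exp (4 * ε ^ 2 * (K + 1 : ℕ)) := by
          rw [← Real.exp_add, ← Real.exp_add]
          push_cast
          ring_nf

end Moment

theorem ae_eventually_le_of_integral_exp_le {Ω : Type*} [MeasurableSpace Ω] {μ : Measure Ω}
    [IsFiniteMeasure μ] {S : ℕ → Ω → ℝ} {τ a b : ℝ} (hτ : 0 ≤ τ) (hab : a < τ * b)
    (hint : ∀ K, Integrable (fun ω => Real.exp (τ * S K ω)) μ)
    (hS : ∀ K : ℕ, ∫ ω, Real.exp (τ * S K ω) ∂μ ≤ Real.exp (a * K)) :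
    ∀ᵐ ω ∂μ, ∀ᶠ K : ℕ in atTop, S K ω ≤ b * K := by
  have htail : ∀ K : ℕ, μ {ω | b * K ≤ S K ω} ≤ ENNReal.ofReal (Real.exp (a - τ * b) ^ K) := by
    intro K
    rw [← ofReal_measureReal]
    refine ENNReal.ofReal_le_ofReal ?_
    calc μ.real {ω | b * K ≤ S K ω}
        ≤ Real.exp (-τ * (b * K)) * ∫ ω, Real.exp (τ * S K ω) ∂μ :=
          ProbabilityTheory.measure_ge_le_exp_mul_mgf _ hτ (hint K)
      _ ≤ Real.exp (-τ * (b * K)) * Real.exp (a * K) := by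
          gcongr
          exact hS K
      _ = Real.exp (a - τ * b) ^ K := by
          rw [← Real.exp_add, ← Real.exp_nat_mul]
          ring_nf
  have hsum : ∑' K : ℕ, μ {ω | b * K ≤ S K ω} ≠ ⊤ :=
    ne_top_of_le_ne_top (summable_geometric_of_lt_one (Real.exp_pos _).le
      (Real.exp_lt_one_iff.2 (sub_neg.2 hab))).tsum_ofReal_ne_top (ENNReal.tsum_le_tsum htail)
  filter_upwards [ae_eventually_notMem hsum] with ω hω
  exact hω.mono fun K hK => (not_le.1 hK).le

theorem exists_ae_eventually_cosSum_le {ν : Measure ℝ} (hν : IsSelfSimilarMeasure ν)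
    (hR : IsRajchman ν) {ε : ℝ} (hε : 0 < ε) :
    ∃ Q D : ℝ, ∀ u θ : ℕ → ℝ, Q ≤ |u 0| → (∀ k, D * |u k| ≤ |u (k + 1)|) →
      ∀ᵐ x ∂ν, ∀ᶠ K : ℕ in atTop, cosSum u θ K x ≤ ε * K := by
  obtain ⟨_, n, Φ, p, hp, hp1, hself⟩ := hν
  obtain ⟨c, hc, hmix⟩ := exists_isMixtureOfCopies hp hself
  obtain ⟨R, hsupp⟩ := exists_ae_abs_le_of_selfSimilar hp hp1 hself
  obtain ⟨τ, hτ0, hτ⟩ := exists_between (lt_min one_pos (by positivity : 0 < ε / 4))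
  obtain ⟨hτ1, hτε⟩ := lt_min_iff.1 hτ
  obtain ⟨Q, hQ, hF⟩ := hR.exists_norm_fourierMode_le hτ0
  have hlarge : ∀ᶠ D : ℝ in atTop, 1 ≤ c * D ∧ 2 * Real.pi * (Q * R) ≤ c * D * τ :=
    ((tendsto_id.const_mul_atTop hc).eventually_ge_atTop _).and
      (((tendsto_id.const_mul_atTop hc).atTop_mul_const hτ0).eventually_ge_atTop _)
  obtain ⟨D, hcD, hRD⟩ := hlarge.exists
  refine ⟨Q, D, fun u θ hu0 hu => ?_⟩
  exact ae_eventually_le_of_integral_exp_le (a := 4 * τ ^ 2) hτ0.le (by nlinarith)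
    (fun K => integrable_exp_mul_cosSum u θ K hτ0.le)
    fun K => integral_exp_cosSum_le hc hmix hsupp hτ0.le hτ1.le hQ hF hcD hRD K u θ hu0 hu

section ArithmeticProgressions

theorem sum_range_mul_eq_sum_sum {M : Type*} [AddCommMonoid M] (a : ℕ → M) (L K : ℕ) :
    ∑ n ∈ Finset.range (L * K), a n
      = ∑ i ∈ Finset.range L, ∑ k ∈ Finset.range K, a (i + L * k) := by
  induction K with
  | zero => simp
  | succ K ih =>
    rw [Nat.mul_succ, Finset.sum_range_add, ih]
    simp only [Finset.sum_range_succ, Finset.sum_add_distrib, add_comm (L * K)]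

theorem eventually_sum_range_le_of_arithmetic_progressions {a : ℕ → ℝ} (ha : ∀ n, a n ≤ 1)
    {L : ℕ} (hL : 0 < L) (j : ℕ) {C C' : ℝ} (hC : 0 ≤ C) (hCC' : C < C')
    (h : ∀ i, ∀ᶠ K : ℕ in atTop, ∑ k ∈ Finset.range K, a (j + (i + L * k)) ≤ C * K) :
    ∀ᶠ N : ℕ in atTop, ∑ n ∈ Finset.range N, a n ≤ C' * N := by
  have hall : ∀ᶠ K : ℕ in atTop, ∀ i ∈ Finset.range L,
      ∑ k ∈ Finset.range K, a (j + (i + L * k)) ≤ C * K :=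
    (eventually_all_finset _).2 fun i _ => h i
  have hK : Tendsto (fun N : ℕ => (N - j) / L) atTop atTop :=
    (Nat.tendsto_div_const_atTop hL.ne').comp (tendsto_sub_atTop_nat j)
  filter_upwards [hK.eventually hall, eventually_ge_atTop j,
    (tendsto_natCast_atTop_atTop.const_mul_atTop (sub_pos.2 hCC')).eventually_ge_atTop
      ((j : ℝ) + L)] with N hN hjN hbig
  obtain ⟨K, m, hm, hKm, hKN⟩ : ∃ K m, m < L ∧ N = j + (L * K + m) ∧ (N - j) / L = K :=
    ⟨_, _, Nat.mod_lt (N - j) hL, by rw [Nat.div_add_mod]; omega, rfl⟩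
  rw [hKN] at hN
  have hLK : (L : ℝ) * K ≤ N := by exact_mod_cast (by omega : L * K ≤ N)
  calc ∑ n ∈ Finset.range N, a n
      = ∑ n ∈ Finset.range j, a n + (∑ n ∈ Finset.range (L * K), a (j + n) +
          ∑ n ∈ Finset.range m, a (j + (L * K + n))) := by
        rw [hKm, Finset.sum_range_add, Finset.sum_range_add]
    _ ≤ j + (L * (C * K) + m) := by
        gcongr
        · exact sum_range_le_of_le_one ha j
        · rw [sum_range_mul_eq_sum_sum fun n => a (j + n)]
          simpa using Finset.sum_le_card_nsmul _ _ _ hN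
        · exact sum_range_le_of_le_one (fun n => ha _) m
    _ ≤ j + (C * N + L) := by
        rw [mul_left_comm]
        gcongr
    _ ≤ C' * N := by linarith

end ArithmeticProgressions

/-- Hadamard lacunary sequences: the moduli of consecutive terms grow at least by a fixed factor
greater than `1`. -/
def IsLacunary (u : ℕ → ℝ) : Prop :=
  u 0 ≠ 0 ∧ ∃ r, 1 < r ∧ ∀ n, r * |u n| ≤ |u (n + 1)|

theorem isLacunary_pow_succ {b : ℝ} (hb : 1 < b) : IsLacunary fun n => b ^ (n + 1) := by
  have : 0 < b := one_pos.trans hb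
  refine ⟨by positivity, b, hb, fun n => ?_⟩
  rw [abs_of_pos (by positivity), abs_of_pos (by positivity), ← pow_succ']

namespace IsLacunary

variable {u : ℕ → ℝ}

theorem const_mul (hu : IsLacunary u) {q : ℝ} (hq : q ≠ 0) : IsLacunary fun n => q * u n := by
  obtain ⟨hu0, r, hr1, hr⟩ := hu
  refine ⟨mul_ne_zero hq hu0, r, hr1, fun n => ?_⟩
  rw [abs_mul, abs_mul, mul_left_comm]
  gcongr
  exact hr n

theorem exists_pow_mul_abs_le (hu : IsLacunary u) :
    ∃ r, 1 < r ∧ ∀ k n, r ^ k * |u n| ≤ |u (n + k)| := by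
  obtain ⟨-, r, hr1, hr⟩ := hu
  refine ⟨r, hr1, fun k n => ?_⟩
  induction k with
  | zero => simp
  | succ k ih =>
    calc r ^ (k + 1) * |u n| = r * (r ^ k * |u n|) := by ring
      _ ≤ r * |u (n + k)| := by gcongr
      _ ≤ |u (n + (k + 1))| := hr (n + k)

theorem eventually_mul_abs_le (hu : IsLacunary u) (D : ℝ) :
    ∀ᶠ L in atTop, ∀ n, D * |u n| ≤ |u (n + L)| := by
  obtain ⟨r, hr1, hr⟩ := hu.exists_pow_mul_abs_le
  filter_upwards [(tendsto_pow_atTop_atTop_of_one_lt hr1).eventually_ge_atTop D] with L hL n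
  exact (mul_le_mul_of_nonneg_right hL (abs_nonneg _)).trans (hr L n)

theorem tendsto_abs_atTop (hu : IsLacunary u) : Tendsto (fun n => |u n|) atTop atTop := by
  obtain ⟨r, hr1, hr⟩ := hu.exists_pow_mul_abs_le
  refine tendsto_atTop_mono (fun n => ?_)
    ((tendsto_pow_atTop_atTop_of_one_lt hr1).atTop_mul_const (abs_pos.2 hu.1))
  simpa using hr n 0

theorem ae_eventually_cosSum_le (hu : IsLacunary u) {ν : Measure ℝ} (hν : IsSelfSimilarMeasure ν)
    (hR : IsRajchman ν) (θ : ℕ → ℝ) :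
    ∀ᵐ x ∂ν, ∀ ε > 0, ∀ᶠ N : ℕ in atTop, cosSum u θ N x ≤ ε * N := by
  have hfixed : ∀ ε > 0, ∀ᵐ x ∂ν, ∀ᶠ N : ℕ in atTop, cosSum u θ N x ≤ ε * N := by
    intro ε hε
    obtain ⟨Q, D, hQD⟩ := exists_ae_eventually_cosSum_le hν hR (half_pos hε)
    obtain ⟨L, hL, hL0⟩ := ((hu.eventually_mul_abs_le D).and (eventually_gt_atTop 0)).exists
    obtain ⟨j, hj⟩ := eventually_atTop.1 (hu.tendsto_abs_atTop.eventually_ge_atTop Q)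
    have hprogressions : ∀ᵐ x ∂ν, ∀ i, ∀ᶠ K : ℕ in atTop,
        cosSum (fun k => u (j + (i + L * k))) (fun k => θ (j + (i + L * k))) K x ≤ ε / 2 * K :=
      ae_all_iff.2 fun i => hQD _ _ (hj _ (Nat.le_add_right _ _)) fun k => by
        simpa only [Nat.mul_succ, ← add_assoc] using hL (j + (i + L * k))
    filter_upwards [hprogressions] with x hx
    exact eventually_sum_range_le_of_arithmetic_progressions (fun n => Real.cos_le_one _) hL0 j
      (half_pos hε).le (half_lt_self hε) hx
  have hseq : ∀ᵐ x ∂ν, ∀ m : ℕ, ∀ᶠ N : ℕ in atTop, cosSum u θ N x ≤ 1 / (m + 1 : ℝ) * N :=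
    ae_all_iff.2 fun m => hfixed _ Nat.one_div_pos_of_nat
  filter_upwards [hseq] with x hx ε hε
  obtain ⟨m, hm⟩ := exists_nat_one_div_lt hε
  exact (hx m).mono fun N hN => hN.trans (by gcongr)

end IsLacunary

/-- The Cesàro mean of the first `N` terms; it is `0` for `N = 0`. -/
noncomputable def cesaroMean {E : Type*} [AddCommMonoid E] [Module ℝ E] (a : ℕ → E) (N : ℕ) : E :=
  (N : ℝ)⁻¹ • ∑ n ∈ Finset.range N, a n

section CesaroMean

theorem cesaroMean_add {E : Type*} [AddCommMonoid E] [Module ℝ E] (a b : ℕ → E) :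
    cesaroMean (fun n => a n + b n) = fun N => cesaroMean a N + cesaroMean b N := by
  ext N
  simp only [cesaroMean, Finset.sum_add_distrib, smul_add]

theorem cesaroMean_const_mul {A : Type*} [Semiring A] [Algebra ℝ A] (c : A) (a : ℕ → A) :
    cesaroMean (fun n => c * a n) = fun N => c * cesaroMean a N := by
  ext N
  simp only [cesaroMean, ← Finset.mul_sum, mul_smul_comm]

theorem cesaroMean_ofReal (a : ℕ → ℝ) :
    cesaroMean (fun n => (a n : ℂ)) = fun N => ((cesaroMean a N : ℝ) : ℂ) := by
  ext N
  simp [cesaroMean]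

theorem cesaroMean_mono {a b : ℕ → ℝ} (hab : ∀ n, a n ≤ b n) (N : ℕ) :
    cesaroMean a N ≤ cesaroMean b N :=
  smul_le_smul_of_nonneg_left (Finset.sum_le_sum fun n _ => hab n) (by positivity)

theorem cesaroMean_le_of_sum_le {a : ℕ → ℝ} {C : ℝ} {N : ℕ} (hC : 0 ≤ C)
    (h : ∑ n ∈ Finset.range N, a n ≤ C * N) : cesaroMean a N ≤ C := by
  rw [cesaroMean, smul_eq_mul, inv_mul_eq_div]
  exact div_le_of_le_mul₀ N.cast_nonneg hC h

theorem dist_cesaroMean_le {E : Type*} [NormedAddCommGroup E] [NormedSpace ℝ E] {a b : ℕ → E}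
    {C : ℝ} (hC : 0 ≤ C) (hab : ∀ n, dist (a n) (b n) ≤ C) (N : ℕ) :
    dist (cesaroMean a N) (cesaroMean b N) ≤ C := by
  rw [cesaroMean, cesaroMean, dist_smul₀, norm_inv, Real.norm_natCast, inv_mul_eq_div]
  refine div_le_of_le_mul₀ N.cast_nonneg hC ((dist_sum_sum_le_of_le _ fun n _ => hab n).trans ?_)
  simp [mul_comm]

theorem tendsto_cesaroMean_of_eventually_le {a : ℕ → ℝ} {l : ℝ}
    (hle : ∀ ε > 0, ∀ᶠ N in atTop, cesaroMean a N ≤ l + ε)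
    (hge : ∀ ε > 0, ∀ᶠ N in atTop, cesaroMean (fun n => -a n) N ≤ -l + ε) :
    Tendsto (cesaroMean a) atTop (𝓝 l) := by
  have hneg : ∀ N, cesaroMean (fun n => -a n) N = -cesaroMean a N := fun N => by
    simpa using congrFun (cesaroMean_const_mul (-1) a) N
  refine Metric.tendsto_nhds.2 fun ε hε => ?_
  filter_upwards [hle _ (half_pos hε), hge _ (half_pos hε)] with N h₁ h₂
  rw [hneg] at h₂
  rw [Real.dist_eq, abs_lt]
  constructor <;> linarith

end CesaroMean

section Weyl

theorem continuous_integral_continuousMap {X : Type*} [TopologicalSpace X] [CompactSpace X]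
    [MeasurableSpace X] [OpensMeasurableSpace X] (μ : Measure X) [IsProbabilityMeasure μ] :
    Continuous fun f : C(X, ℂ) => ∫ x, f x ∂μ := by
  have hint : ∀ f : C(X, ℂ), Integrable f μ := fun f =>
    (BoundedContinuousFunction.mkOfCompact f).integrable μ
  refine (LipschitzWith.of_dist_le' (K := 1) fun f g => ?_).continuous
  rw [dist_eq_norm, ← integral_sub (hint f) (hint g), one_mul]
  simpa using norm_integral_le_of_norm_le_const (μ := μ) (f := fun x => f x - g x) (C := dist f g)
    (.of_forall fun x => by rw [← dist_eq_norm]; exact ContinuousMap.dist_apply_le_dist x)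

variable {T : ℝ} [Fact (0 < T)]

theorem integral_fourier_haarAddCircle (q : ℤ) :
    ∫ t, fourier q t ∂(AddCircle.haarAddCircle (T := T)) = if q = 0 then 1 else 0 := by
  have h := congrFun (fourierCoeff_fourier (T := T) q) 0
  rw [Pi.single_apply] at h
  simpa [fourierCoeff, eq_comm] using h

theorem tendsto_cesaroMean_of_mem_span_fourier {y : ℕ → AddCircle T}
    (hy : ∀ q : ℤ, q ≠ 0 → Tendsto (cesaroMean fun n => fourier q (y n)) atTop (𝓝 0))
    {f : C(AddCircle T, ℂ)} (hf : f ∈ Submodule.span ℂ (Set.range (fourier (T := T)))) :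
    Tendsto (cesaroMean fun n => f (y n)) atTop (𝓝 (∫ t, f t ∂AddCircle.haarAddCircle)) := by
  have hint : ∀ f : C(AddCircle T, ℂ), Integrable f AddCircle.haarAddCircle := fun f =>
    (BoundedContinuousFunction.mkOfCompact f).integrable _
  induction hf using Submodule.span_induction with
  | mem f hf =>
    obtain ⟨q, rfl⟩ := hf
    rw [integral_fourier_haarAddCircle]
    split_ifs with hq
    · simp only [hq, fourier_zero]
      exact tendsto_const_nhds.cesaro_smul
    · exact hy q hq
  | zero =>
    simp only [ContinuousMap.zero_apply, integral_zero]
    exact tendsto_const_nhds.cesaro_smul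
  | add f g _ _ hf hg =>
    simpa [cesaroMean_add, integral_add (hint f) (hint g)] using hf.add hg
  | smul c f _ hf =>
    simpa [cesaroMean_const_mul, integral_const_mul] using hf.const_mul c

theorem tendsto_cesaroMean_of_tendsto_cesaroMean_fourier {y : ℕ → AddCircle T}
    (hy : ∀ q : ℤ, q ≠ 0 → Tendsto (cesaroMean fun n => fourier q (y n)) atTop (𝓝 0))
    (f : C(AddCircle T, ℂ)) :
    Tendsto (cesaroMean fun n => f (y n)) atTop (𝓝 (∫ t, f t ∂AddCircle.haarAddCircle)) := by
  have hlip : ∀ N, LipschitzWith 1 fun f : C(AddCircle T, ℂ) => cesaroMean (fun n => f (y n)) N :=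
    fun N => LipschitzWith.of_dist_le_mul fun f g => by
      simpa using dist_cesaroMean_le dist_nonneg
        (fun n => ContinuousMap.dist_apply_le_dist (f := f) (g := g) (y n)) N
  have hclosed : IsClosed {f : C(AddCircle T, ℂ) | Tendsto (cesaroMean fun n => f (y n)) atTop
      (𝓝 (∫ t, f t ∂AddCircle.haarAddCircle))} :=
    (LipschitzWith.uniformEquicontinuous _ 1 hlip).equicontinuous.isClosed_setOfPred_tendsto
      (continuous_integral_continuousMap _)
  have hf : f ∈ closure (Submodule.span ℂ (Set.range (fourier (T := T))) : Set _) := by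
    rw [← Submodule.topologicalClosure_coe, span_fourier_closure_eq_top]
    trivial
  exact closure_minimal (fun g hg => tendsto_cesaroMean_of_mem_span_fourier hy hg) hclosed hf

end Weyl

/-- Uniform distribution modulo one, tested against the continuous functions on `[0, 1]`, which
may take different values at the two endpoints. -/
def IsEquidistributedModOne (z : ℕ → ℝ) : Prop :=
  ∀ g : ℝ → ℝ, ContinuousOn g (Set.Icc 0 1) →
    Tendsto (cesaroMean fun n => g (Int.fract (z n))) atTop (𝓝 (∫ t in Set.Icc (0 : ℝ) 1, g t))

section ModOne

variable {z : ℕ → ℝ}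

theorem integral_liftIco_haarAddCircle (g : ℝ → ℝ) :
    ∫ t, AddCircle.liftIco 1 0 g t ∂AddCircle.haarAddCircle = ∫ t in Set.Icc (0 : ℝ) 1, g t := by
  rw [AddCircle.integral_haarAddCircle, inv_one, one_smul, ← UnitAddCircle.integral_preimage 0,
    zero_add, integral_Icc_eq_integral_Ioo, integral_Ioc_eq_integral_Ioo]
  refine setIntegral_congr_fun measurableSet_Ioo fun t ht => ?_
  exact AddCircle.liftIco_zero_coe_apply (Set.Ioo_subset_Ico_self ht)

theorem tendsto_cesaroMean_fract_of_eq_endpoints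
    (hz : ∀ q : ℤ, q ≠ 0 →
      Tendsto (cesaroMean fun n => fourier q (z n : UnitAddCircle)) atTop (𝓝 0))
    {g : ℝ → ℝ} (hg : ContinuousOn g (Set.Icc 0 1)) (hg01 : g 0 = g 1) :
    Tendsto (cesaroMean fun n => g (Int.fract (z n))) atTop
      (𝓝 (∫ t in Set.Icc (0 : ℝ) 1, g t)) := by
  have hcont : Continuous (AddCircle.liftIco 1 0 g) := AddCircle.liftIco_zero_continuous hg01 hg
  have hlift : ∀ t : ℝ, AddCircle.liftIco 1 0 g (t : UnitAddCircle) = g (Int.fract t) := fun t => by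
    rw [← AddCircle.coe_fract,
      AddCircle.liftIco_zero_coe_apply ⟨Int.fract_nonneg t, Int.fract_lt_one t⟩]
  have h := tendsto_cesaroMean_of_tendsto_cesaroMean_fourier hz
    ⟨fun t => ((AddCircle.liftIco 1 0 g t : ℝ) : ℂ), Complex.continuous_ofReal.comp hcont⟩
  simpa only [ContinuousMap.coe_mk, hlift, cesaroMean_ofReal, integral_complex_ofReal,
    integral_liftIco_haarAddCircle, tendsto_ofReal_iff] using h

theorem setIntegral_two_mul_sub_one_pow (m : ℕ) :
    ∫ t in Set.Icc (0 : ℝ) 1, (2 * t - 1) ^ (2 * m) = 1 / (2 * m + 1) := by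
  rw [integral_Icc_eq_integral_Ioc, ← intervalIntegral.integral_of_le zero_le_one,
    intervalIntegral.integral_comp_mul_sub (fun t : ℝ => t ^ (2 * m)) two_ne_zero, integral_pow]
  have : (-1 : ℝ) ^ (2 * m + 1) = -1 := Odd.neg_one_pow ⟨m, rfl⟩
  norm_num [this]
  field_simp

theorem exists_majorant_eq_endpoints {g : ℝ → ℝ} (hg : ContinuousOn g (Set.Icc 0 1)) {δ : ℝ}
    (hδ : 0 < δ) :
    ∃ h : ℝ → ℝ, ContinuousOn h (Set.Icc 0 1) ∧ h 0 = h 1 ∧ (∀ t ∈ Set.Icc 0 1, g t ≤ h t) ∧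
      ∫ t in Set.Icc (0 : ℝ) 1, h t ≤ (∫ t in Set.Icc (0 : ℝ) 1, g t) + δ := by
  obtain ⟨C, hC⟩ := isCompact_Icc.exists_bound_of_continuousOn hg
  have hgC : ∀ t ∈ Set.Icc (0 : ℝ) 1, |g t| ≤ C := hC
  have hlim : Tendsto (fun m : ℕ => 2 * C * (1 / (2 * m + 1))) atTop (𝓝 0) := by
    have hodd : Tendsto (fun m : ℕ => 2 * (m : ℝ) + 1) atTop atTop :=
      tendsto_atTop_add_const_right _ _
        (tendsto_natCast_atTop_atTop.const_mul_atTop two_pos)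
    simpa using hodd.inv_tendsto_atTop.const_mul (2 * C)
  obtain ⟨m, hm⟩ := (hlim.eventually_le_const hδ).exists
  -- The weight `(2 * t - 1) ^ (2 * m)` is `1` at both endpoints and has small integral.
  set w : ℝ → ℝ := fun t => (2 * t - 1) ^ (2 * m)
  have hw : Continuous w := by fun_prop
  have hw0 : ∀ t, 0 ≤ w t := fun t => (even_two_mul m).pow_nonneg _
  have hgw : ContinuousOn (fun t => g t + (C - g t) * w t) (Set.Icc 0 1) := by fun_prop
  refine ⟨fun t => g t + (C - g t) * w t, hgw, by norm_num [w], fun t ht => ?_, ?_⟩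
  · have hgt := (abs_le.1 (hgC t ht)).2
    exact le_add_of_nonneg_right (mul_nonneg (sub_nonneg.2 hgt) (hw0 t))
  · calc ∫ t in Set.Icc (0 : ℝ) 1, (g t + (C - g t) * w t)
        ≤ ∫ t in Set.Icc (0 : ℝ) 1, (g t + 2 * C * w t) := by
          refine setIntegral_mono_on hgw.integrableOn_Icc ?_ measurableSet_Icc fun t ht => ?_
          · exact ContinuousOn.integrableOn_Icc (by fun_prop)
          · have hgt := (abs_le.1 (hgC t ht)).1
            gcongr
            · exact hw0 t
            · linarith
      _ = (∫ t in Set.Icc (0 : ℝ) 1, g t) + 2 * C * (1 / (2 * m + 1)) := by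
          rw [integral_add hg.integrableOn_Icc
            (hw.continuousOn.integrableOn_Icc.const_mul _), integral_const_mul,
            setIntegral_two_mul_sub_one_pow]
      _ ≤ _ := by gcongr

theorem isEquidistributedModOne_of_tendsto_cesaroMean_fourier
    (hz : ∀ q : ℤ, q ≠ 0 →
      Tendsto (cesaroMean fun n => fourier q (z n : UnitAddCircle)) atTop (𝓝 0)) :
    IsEquidistributedModOne z := by
  have hupper : ∀ g : ℝ → ℝ, ContinuousOn g (Set.Icc 0 1) → ∀ ε > 0, ∀ᶠ N in atTop,
      cesaroMean (fun n => g (Int.fract (z n))) N ≤ (∫ t in Set.Icc (0 : ℝ) 1, g t) + ε := by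
    intro g hg ε hε
    obtain ⟨h, hh, h01, hgh, hint⟩ := exists_majorant_eq_endpoints hg (half_pos hε)
    have hlim := tendsto_cesaroMean_fract_of_eq_endpoints hz hh h01
    filter_upwards [hlim.eventually_le_const (by linarith :
      ∫ t in Set.Icc (0 : ℝ) 1, h t < (∫ t in Set.Icc (0 : ℝ) 1, g t) + ε)] with N hN
    refine (cesaroMean_mono (fun n => hgh _ ?_) N).trans hN
    exact ⟨Int.fract_nonneg _, (Int.fract_lt_one _).le⟩
  intro g hg
  exact tendsto_cesaroMean_of_eventually_le (hupper g hg) fun ε hε => by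
    simpa only [Pi.neg_apply, integral_neg] using hupper _ hg.neg ε hε

theorem tendsto_cesaroMean_fourier_of_eventually_sum_cos_le {q : ℤ}
    (h : ∀ m : ℕ, ∀ ε > 0, ∀ᶠ N : ℕ in atTop, ∑ n ∈ Finset.range N,
      Real.cos (2 * Real.pi * (q * z n) + m * (Real.pi / 2)) ≤ ε * N) :
    Tendsto (cesaroMean fun n => fourier q (z n : UnitAddCircle)) atTop (𝓝 0) := by
  have hmean : ∀ m : ℕ, ∀ ε > 0, ∀ᶠ N : ℕ in atTop, cesaroMean (fun n =>
      Real.cos (2 * Real.pi * (q * z n) + m * (Real.pi / 2))) N ≤ ε := fun m ε hε =>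
    (h m ε hε).mono fun N hN => cesaroMean_le_of_sum_le (le_of_lt hε) hN
  have hcos : Tendsto (cesaroMean fun n => Real.cos (2 * Real.pi * (q * z n))) atTop (𝓝 0) :=
    tendsto_cesaroMean_of_eventually_le (by simpa using hmean 0) (by
      simpa [Real.cos_add_pi, mul_div_cancel₀] using hmean 2)
  have hsin : Tendsto (cesaroMean fun n => Real.sin (2 * Real.pi * (q * z n))) atTop (𝓝 0) := by
    have hthree : ∀ x, Real.cos (x + 3 * (Real.pi / 2)) = Real.sin x := fun x => by
      rw [show x + 3 * (Real.pi / 2) = x + Real.pi + Real.pi / 2 by ring,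
        Real.cos_add_pi_div_two, Real.sin_add_pi, neg_neg]
    exact tendsto_cesaroMean_of_eventually_le (by simpa [hthree] using hmean 3)
      (by simpa [Real.cos_add_pi_div_two] using hmean 1)
  have hexp : ∀ n, fourier q (z n : UnitAddCircle) = (Real.cos (2 * Real.pi * (q * z n)) : ℂ) +
      Complex.I * (Real.sin (2 * Real.pi * (q * z n)) : ℂ) := fun n => by
    rw [fourier_coe_apply, Complex.ofReal_cos, Complex.ofReal_sin, mul_comm Complex.I,
      ← Complex.exp_mul_I]
    push_cast
    ring_nf
  have hlim := (tendsto_ofReal_iff.2 hcos).add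
    ((tendsto_ofReal_iff.2 hsin).const_mul Complex.I)
  simpa only [hexp, cesaroMean_add, cesaroMean_const_mul, cesaroMean_ofReal, Complex.ofReal_zero,
    mul_zero, add_zero] using hlim

end ModOne

theorem timesMap_iterate (b : ℕ) (x : ℝ) {n : ℕ} (hn : 1 ≤ n) :
    (timesMap b)^[n] x = Int.fract ((b : ℝ) ^ n * x) := by
  induction n, hn using Nat.le_induction with
  | base => simp [timesMap]
  | succ n _ ih =>
    rw [Function.iterate_succ_apply', ih, timesMap, Int.fract_eq_fract]
    refine ⟨-(b * ⌊(b : ℝ) ^ n * x⌋), ?_⟩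
    rw [Int.fract]
    push_cast
    ring

theorem IsEquidistributedModOne.isNormalToBase {b : ℕ} {x : ℝ}
    (h : IsEquidistributedModOne fun n => (b : ℝ) ^ (n + 1) * x) : IsNormalToBase b x := by
  intro g hg
  refine (h g hg).congr fun N => ?_
  rw [cesaroMean, smul_eq_mul, one_div, ← Finset.Ico_add_one_right_eq_Icc,
    Finset.sum_Ico_eq_sum_range, Nat.add_sub_cancel]
  congr 1
  refine Finset.sum_congr rfl fun n _ => ?_
  rw [timesMap_iterate b x (Nat.le_add_right 1 n), add_comm 1]

theorem theorem1p2_general {ν : Measure ℝ} (hν : IsSelfSimilarMeasure ν) (hR : IsRajchman ν)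
    {u : ℕ → ℝ} (hu : IsLacunary u) : ∀ᵐ x ∂ν, IsEquidistributedModOne fun n => u n * x := by
  have hsums : ∀ᵐ x ∂ν, ∀ q : ℤ, q ≠ 0 → ∀ m : ℕ, ∀ ε > 0, ∀ᶠ N : ℕ in atTop,
      cosSum (fun n => q * u n) (fun _ => m * (Real.pi / 2)) N x ≤ ε * N := by
    refine ae_all_iff.2 fun q => eventually_imp_distrib_left.2 fun hq => ae_all_iff.2 fun m => ?_
    exact (hu.const_mul (Int.cast_ne_zero.2 hq)).ae_eventually_cosSum_le hν hR _
  filter_upwards [hsums] with x hx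
  refine isEquidistributedModOne_of_tendsto_cesaroMean_fourier fun q hq =>
    tendsto_cesaroMean_fourier_of_eventually_sum_cos_le fun m => ?_
  simpa only [cosSum, mul_assoc] using hx q hq m

theorem theorem1p2 (ν : Measure ℝ) (hν : IsSelfSimilarMeasure ν) (hna : ∀ x : ℝ, ν {x} = 0)
    (hR : IsRajchman ν) : IsPointwiseAbsolutelyNormal ν := by
  have hbase : ∀ b : ℕ, 2 ≤ b → ∀ᵐ x ∂ν, IsNormalToBase b x := fun b hb =>
    (theorem1p2_general hν hR (isLacunary_pow_succ (Nat.one_lt_cast.2 hb))).mono fun x hx =>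
      hx.isNormalToBase
  exact ae_all_iff.2 fun b => eventually_imp_distrib_left.2 (hbase b)
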